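/- **Setting.** Let $0<\omega_1<\omega_2$ with $\omega_2/\omega_1\in\mathbb N$, let $n_c,n_\rho,n_r,r,N$ be positive integers with $n_c=\frac{\omega_1}{\omega_2}n_\rho$, $n_r\mid n_c$, $n_r\mid n_\rho$, and let $\alpha>0$, $B_{out}>0$. Write $\|\cdot\|_F$ for the Frobenius norm, $\|\cdot\|_2$ for the spectral norm, and $c_\omega=\frac{e^{i\pi/4}\omega^2}{\sqrt{8\pi\omega}}$. For $\Lambda=\begin{bmatrix}\Lambda^{\omega_1}\\ \Lambda^{\omega_2}\end{bmatrix}\in\mathbb C^{2n_c\times n_c}$ and $m=1,\dots,n_c$ let $\Lambda^{\omega}_{\theta_m}[i,j]=\Lambda^{\omega}[i+m,j+m]$ (indices modulo $n_c$). For $K\in\mathbb C^{n_c\times n_\rho}$ and $D\in\mathbb C^{n_c\times n_c}$ define row vectors of length $n_\rho$ by $$\phi_1 X=-\tfrac{2\pi^2c_\omega}{n_c^2}\,\mathrm{diag}\big(K^*(D^*XD+DXD^*)K\big),\qquad \phi_2X=\tfrac{4\pi^2c_\omega}{n_c^2}\,\mathrm{diag}\big(K^*XK\big)\qquad (X=\Lambda^\omega_{\theta_m}),$$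 and let $\phi(\Lambda)\in\mathbb C^{2n_c\times n_c}$ be the sum over $\omega\in\{\omega_1,\omega_2\}$ of the matrices whose upper (for $j=1$) and lower (for $j=2$) $n_c\times n_c$ blocks have the entry $(\phi_j\Lambda^{\omega}_{\theta_m})[\tfrac{\omega}{\omega_1}k]$ in row $m$ and column $k$, $1\le m,k\le n_c$. $\mathcal H^1_{BFNN}$ is the set of all such $\phi$ with $K=UMV$, where $U=\mathrm{diag}(U_1,\dots,U_{n_r})$ with $U_i\in\mathbb C^{\frac{n_c}{n_r}\times n_rr}$, $V=\mathrm{diag}(V_1,\dots,V_{n_r})$ with $V_i\in\mathbb C^{n_rr\times\frac{n_\rho}{n_r}}$, $M=(M_{ij})_{i,j=1}^{n_r}$ with $M_{ij}=(M^{ij}_{kl})_{k,l=1}^{n_r}$, $M^{ij}_{kl}\in\mathbb C^{r\times r}$, $M^{ij}_{kl}=0$ unless $(k,l)=(j,i)$, and $\|U\|_2\le B_U$, $\|M\|_2\le B_M$, $\|V\|_2\le B_V$, $\|D\|_2\le B_D$. $\mathcal H^1$ is the set of all $h=\psi\circ\psi_0\circ\phi$ with $\phi\in\mathcal H^1_{BFNN}$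 and real-linear maps $\psi_0:\mathbb C^{2n_c\times n_c}\to\mathbb R^{2n_c\times n_c}$, $\psi:\mathbb R^{2n_c\times n_c}\to\mathbb R^{2n_c\times n_c}$ satisfying $\|\psi_0(X)\|_F\le2\|X\|_F$ and $\|\psi(Y)\|_F\le2\alpha^{-1}\|Y\|_F$ for all $X$, $Y$. Let $\mu$ be a probability measure on pairs $(\Lambda,(\gamma,\eta)^T)\in\mathbb C^{2n_c\times n_c}\times\mathbb R^{2n_c\times n_c}$ such that $\mu$-almost surely $\|\Lambda\|_F\le B_{in}$, $\|(\gamma,\eta)^T\|_F\le B_{tgt}$, $\|\phi(\Lambda)\|_F\le B_{out}$ for all $\phi\in\mathcal H^1_{BFNN}$, and $\|h(\Lambda)\|_F\le B_{out}$ for all $h\in\mathcal H^1$. Let $\mathcal S=\{(\Lambda_s,(\gamma_s,\eta_s)^T)\}_{s=1}^N$ be drawn i.i.d. from $\mu$, and put $$\mathcal L(h)=\mathbb E_{\mu}\|h(\Lambda)-(\gamma,\eta)^T\|_F,\qquad \hat{\mathcal L}(h)=\frac1N\sum_{s=1}^N\|h(\Lambda_s)-(\gamma_s,\eta_s)^T\|_F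 .$$ **Theorem (generalization of compressed neural networks).** Assume $\frac{\omega_2}{\omega_1}n_rr\le n_c$. Then for every $\delta\in(0,1)$, with probability at least $1-\delta$ over $\mathcal S$, simultaneously for all $h\in\mathcal H^1$, $$\mathcal L(h)\le\hat{\mathcal L}(h)+2^2\Big(\sqrt{2\ln(4\delta^{-1})}\,(B_{out}+B_{tgt})+2^6\,3\sqrt2\,B_{out}\,\alpha^{-1}\big(1+c_1B_{out}^{-1}n_c^{-\frac32}\big)^{\frac12}n_c^3\Big)N^{-\frac12},$$ where $c_1=2^6\pi^2\,(|c_{\omega_1}|+|c_{\omega_2}|)\,(B_D^4+1)^{\frac12}B_U^2B_M^2B_V^2B_{in}$. -/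

import Mathlib

open MeasureTheory
open scoped Matrix Matrix.Norms.Frobenius

/- In this file the norm of a matrix is the Frobenius norm (opened above); the spectral norm is
`BFNN.specNorm` below. -/

namespace BFNN

/-- The product (equivalently, Borel) sigma-algebra on real or complex matrices. -/
instance instMeasurableSpaceMatrix {m n α : Type*} [MeasurableSpace α] :
    MeasurableSpace (Matrix m n α) :=
  inferInstanceAs (MeasurableSpace (m → n → α))

/-- The spectral norm `‖A‖₂`: the operator norm between Euclidean spaces. -/
noncomputable def specNorm {m n : Type*} [Fintype m] [Fintype n] [DecidableEq n]
    (A : Matrix m n ℂ) : ℝ :=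
  ‖LinearMap.toContinuousLinearMap (Matrix.toEuclideanLin A)‖

/-- Scattering data and outputs of a butterfly network: complex `2n × n` matrices, the rows being
split into an upper (`Sum.inl`) and a lower (`Sum.inr`) block of `n` rows each. -/
abbrev CMat (n : ℕ) : Type := Matrix (Fin n ⊕ Fin n) (Fin n) ℂ

/-- Perturbations `(γ, η)ᵀ` and outputs of the full network: real `2n × n` matrices. -/
abbrev RMat (n : ℕ) : Type := Matrix (Fin n ⊕ Fin n) (Fin n) ℝ

/-- `c_ω = e^{iπ/4} ω² / √(8πω)`. -/
noncomputable def cOmega (ω : ℝ) : ℂ :=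
  Complex.exp (Complex.I * (Real.pi / 4 : ℝ)) * ((ω ^ 2 / √(8 * Real.pi * ω) : ℝ) : ℂ)

/-- `P_u = [I O]`. -/
def Pu (n : ℕ) : Matrix (Fin n) (Fin n ⊕ Fin n) ℂ := Matrix.fromCols 1 0

/-- `P_l = [O I]`. -/
def Pl (n : ℕ) : Matrix (Fin n) (Fin n ⊕ Fin n) ℂ := Matrix.fromCols 0 1

/-- `P_{1,θ_s}`, the cyclic shift with `(P_{1,θ_s} X)[i, j] = X[i + s, j]` (indices mod `n`). -/
def P1 (n s : ℕ) : Matrix (Fin n) (Fin n) ℂ :=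
  Matrix.of fun i k => if (k : ℕ) = ((i : ℕ) + s) % n then 1 else 0

/-- `P_{2,θ_s}`, the cyclic shift with `(X P_{2,θ_s})[i, j] = X[i, j + s]` (indices mod `n`). -/
def P2 (n s : ℕ) : Matrix (Fin n) (Fin n) ℂ :=
  Matrix.of fun k j => if (k : ℕ) = ((j : ℕ) + s) % n then 1 else 0

/-- The column selection matrix `P_ω`: in one-based indices, `P_ω[i, j] = 1` if
`i = (ω / ω₁) j`, and `0` otherwise. -/
noncomputable def POmega (n nρ : ℕ) (ω₁ ω : ℝ) : Matrix (Fin nρ) (Fin n) ℂ :=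
  open Classical in
  Matrix.of fun i j => if ((i : ℕ) : ℝ) + 1 = ω / ω₁ * (((j : ℕ) : ℝ) + 1) then 1 else 0

/-- The row vector
`φ₁ X = -(2π² c_ω / n²) diag (K* (D* X D + D X D*) K)`. -/
noncomputable def phi1 {n nρ : ℕ} (ω : ℝ) (K : Matrix (Fin n) (Fin nρ) ℂ)
    (D X : Matrix (Fin n) (Fin n) ℂ) : Fin nρ → ℂ :=
  (-(2 * (Real.pi : ℂ) ^ 2 * cOmega ω / (n : ℂ) ^ 2)) •
    Matrix.diag (Kᴴ * (Dᴴ * X * D + D * X * Dᴴ) * K)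

/-- The row vector `φ₂ X = (4π² c_ω / n²) diag (K* X K)`. -/
noncomputable def phi2 {n nρ : ℕ} (ω : ℝ) (K : Matrix (Fin n) (Fin nρ) ℂ)
    (X : Matrix (Fin n) (Fin n) ℂ) : Fin nρ → ℂ :=
  (4 * (Real.pi : ℂ) ^ 2 * cOmega ω / (n : ℂ) ^ 2) • Matrix.diag (Kᴴ * X * K)

/-- The two channels of frequency `ω`; `X` is the block `Λ^ω` of the scattering data.  The `m`-th
row (one-based) of the matrices between `P_uᵀ`, `P_lᵀ` and `P_ω` is `φ_j` applied to the
shifted data `P_{1,θ_m} X P_{2,θ_m}`. -/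
noncomputable def channel {n nρ : ℕ} (ω₁ ω : ℝ) (K : Matrix (Fin n) (Fin nρ) ℂ)
    (D X : Matrix (Fin n) (Fin n) ℂ) : CMat n :=
  (Pu n)ᵀ *
      Matrix.of (fun m : Fin n => phi1 ω K D (P1 n (m + 1) * X * P2 n (m + 1))) *
      POmega n nρ ω₁ ω +
    (Pl n)ᵀ *
      Matrix.of (fun m : Fin n => phi2 ω K (P1 n (m + 1) * X * P2 n (m + 1))) *
      POmega n nρ ω₁ ω

/-- The butterfly network with weights `K` and `D`. -/
noncomputable def bfnn {n nρ : ℕ} (ω₁ ω₂ : ℝ) (K : Matrix (Fin n) (Fin nρ) ℂ)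
    (D : Matrix (Fin n) (Fin n) ℂ) (Λ : CMat n) : CMat n :=
  channel ω₁ ω₁ K D (Pu n * Λ) + channel ω₁ ω₂ K D (Pl n * Λ)

/-- The inner index set, of size `n_r² r`: the triple `(i, m, a)` is the entry number `a` of the
sub-block `m` of the block `i`. -/
abbrev Inner (nr r : ℕ) : Type := Fin nr × Fin nr × Fin r

/-- `U = diag (U_1, …, U_{n_r})` with `U_i` of size `(n / n_r) × (n_r r)`. -/
def IsBlockU {n nr r : ℕ} (U : Matrix (Fin n) (Inner nr r) ℂ) : Prop :=
  ∀ (i : Fin n) (k : Inner nr r), (i : ℕ) / (n / nr) ≠ (k.1 : ℕ) → U i k = 0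

/-- `V = diag (V_1, …, V_{n_r})` with `V_i` of size `(n_r r) × (n_ρ / n_r)`. -/
def IsBlockV {nρ nr r : ℕ} (V : Matrix (Inner nr r) (Fin nρ) ℂ) : Prop :=
  ∀ (k : Inner nr r) (j : Fin nρ), (j : ℕ) / (nρ / nr) ≠ (k.1 : ℕ) → V k j = 0

/-- `M = (M_{ij})` with `M_{ij} = (M^{ij}_{mn})`, where the `r × r` sub-block `M^{ij}_{mn}`
vanishes unless `(m, n) = (j, i)`. -/
def IsBlockM {nr r : ℕ} (M : Matrix (Inner nr r) (Inner nr r) ℂ) : Prop :=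
  ∀ (i m : Fin nr) (a : Fin r) (j l : Fin nr) (b : Fin r),
    ¬ (m = j ∧ l = i) → M (i, m, a) (j, l, b) = 0

/-- The class of compressed butterfly networks, in which `K = U M V`. -/
def hypBFNN (n nρ nr r : ℕ) (ω₁ ω₂ BU BM BV BD : ℝ) : Set (CMat n → CMat n) :=
  {φ | ∃ (U : Matrix (Fin n) (Inner nr r) ℂ) (M : Matrix (Inner nr r) (Inner nr r) ℂ)
      (V : Matrix (Inner nr r) (Fin nρ) ℂ) (D : Matrix (Fin n) (Fin n) ℂ),
      IsBlockU U ∧ IsBlockM M ∧ IsBlockV V ∧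
      specNorm U ≤ BU ∧ specNorm M ≤ BM ∧ specNorm V ≤ BV ∧ specNorm D ≤ BD ∧
      φ = bfnn ω₁ ω₂ (U * M * V) D}

/-- The class of compressed networks `h = ψ ∘ ψ₀ ∘ φ`, where `ψ₀` and `ψ` are real-linear with
operator norms (for the Frobenius norms) at most `2` and `2 α⁻¹`. -/
def hypNet (n nρ nr r : ℕ) (ω₁ ω₂ α BU BM BV BD : ℝ) : Set (CMat n → RMat n) :=
  {h | ∃ (ψ : RMat n →ₗ[ℝ] RMat n) (ψ₀ : CMat n →ₗ[ℝ] RMat n) (φ : CMat n → CMat n),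
      (∀ Y, ‖ψ Y‖ ≤ 2 * α⁻¹ * ‖Y‖) ∧ (∀ X, ‖ψ₀ X‖ ≤ 2 * ‖X‖) ∧
      φ ∈ hypBFNN n nρ nr r ω₁ ω₂ BU BM BV BD ∧ h = ψ ∘ ψ₀ ∘ φ}

/-- The true loss: the expectation of the Frobenius distance between the output and the target. -/
noncomputable def trueLoss {n : ℕ} (μ : Measure (CMat n × RMat n)) (h : CMat n → RMat n) : ℝ :=
  ∫ z, ‖h z.1 - z.2‖ ∂μ

/-- The empirical risk on the training set `S`. -/
noncomputable def empRisk {n N : ℕ} (S : Fin N → CMat n × RMat n) (h : CMat n → RMat n) : ℝ :=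
  1 / (N : ℝ) * ∑ s, ‖h (S s).1 - (S s).2‖

/-- `c₁ = 2⁶ π² (|c_{ω₁}| + |c_{ω₂}|) (B_D⁴ + 1)^{1/2} B_U² B_M² B_V² B_in`. -/
noncomputable def cOne (ω₁ ω₂ BU BM BV BD Bin : ℝ) : ℝ :=
  2 ^ 6 * Real.pi ^ 2 * (‖cOmega ω₁‖ + ‖cOmega ω₂‖) * √(BD ^ 4 + 1) *
    BU ^ 2 * BM ^ 2 * BV ^ 2 * Bin

end BFNN

/-!
A butterfly network depends on its weights `U`, `M`, `V`, `D` in a complicated way, but it is linear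
in the scattering data `Λ`, and so is every network `h = ψ ∘ ψ₀ ∘ φ` (`isLinearMap_of_mem_hypNet`).
On almost all data its output is bounded by `R = 4 α⁻¹ Bout` (`norm_le_of_mem_hypNet`). It is
therefore enough to bound the generalization gap of linear predictors `A` between real vector spaces
of the dimensions `p = 4 n²` and `d = 2 n²` that satisfy `‖A x‖ ≤ R` on the data, for the loss
`‖A x - y‖`. No covering numbers are needed.

The largest deviation `sup_A (L(A) - L̂(A))` changes by at most `(Bout + Btgt) / N` when one sample
point is changed, so that by the bounded differences inequality
(`measureReal_le_of_bounded_differences`) it exceeds its mean by more than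
`(Bout + Btgt) √(2 ln δ⁻¹ / N)` with probability at most `δ`. The mean is at most twice the
Rademacher average of the losses by symmetrization (`integral_iSup_le_of_expect_le`).

In the Rademacher average, a contraction argument (`expect_iSup_le_contraction`) replaces the loss at
the sample point `x_s` by `d σ_s` times the `k_s`-th coordinate of `A x_s`, with `k_s` uniformly
random. For each `k` the vector `(A x_s)_k`, `s = 1, …, N`, lies in the space `W` of all vectors
`(ℓ x_s)_s` with `ℓ` in the dual of the input space; its dimension is at most `p`. Expanding in an
orthonormal basis of `W` and using the Cauchy-Schwarz inequality gives the bound `d √p √N R` for the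
sum (`expect_iSup_linear_le`). Altogether the mean is at most `2 d √p R / √N = 32 Bout α⁻¹ n³ / √N`,
which is within the bound claimed, because the factor containing `cOne` is at least `1`.

Suprema are taken over a countable dense set of predictors, and the data are replaced by `0` on a
null set off which the almost sure bounds hold.
-/

namespace BFNN

/-! ### The bounded differences inequality -/

/-- The moment generating function in the bounded differences inequality: a function of `N`
independent variables that changes by at most `c` when one of them is changed is sub-Gaussian with
variance proxy `N c²`. The first variable is integrated out with Hoeffding's lemma, and its average
has bounded differences in the remaining ones. -/
theorem integral_exp_le_of_bounded_differences {Z : Type*} [MeasurableSpace Z]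
    (μ : Measure Z) [IsProbabilityMeasure μ] {c C : ℝ} (t : ℝ) :
    ∀ (N : ℕ) (f : (Fin N → Z) → ℝ), Measurable f → (∀ S, |f S| ≤ C) →
      (∀ S s z, |f (Function.update S s z) - f S| ≤ c) →
      ∫ S, Real.exp (t * f S) ∂(Measure.pi fun _ : Fin N => μ) ≤
        Real.exp (t * ∫ S, f S ∂(Measure.pi fun _ : Fin N => μ) + N * (c ^ 2 * t ^ 2 / 2)) := by
  intro N
  induction N with
  | zero =>
    intro f _ _ _
    have h : ∀ S, f S = f default := fun S => congrArg f (Subsingleton.elim _ _)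
    simp [h]
  | succ N ih =>
    intro f hf hC hd
    let P := Measure.pi fun _ : Fin N => μ
    let e := MeasurableEquiv.piFinSuccAbove (fun _ : Fin (N + 1) => Z) 0
    have he := (measurePreserving_piFinSuccAbove (fun _ : Fin (N + 1) => μ) 0).symm
    let F : Z × (Fin N → Z) → ℝ := fun p => f (e.symm p)
    have hF : Measurable F := hf.comp e.symm.measurable
    have hFcons : ∀ z S, F (z, S) = f (Fin.cons z S) := by
      intro z S
      have h : e.symm (z, S) = Fin.cons z S := Fin.insertNth_zero' z S
      simp only [F, h]
    have hFC : ∀ p, |F p| ≤ C := fun p => hC _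
    have h1 : ∀ g : (Fin (N + 1) → Z) → ℝ, ∫ S, g S ∂(Measure.pi fun _ : Fin (N + 1) => μ) =
        ∫ p, g (e.symm p) ∂(μ.prod P) := fun g => (he.integral_comp' g).symm
    have hintF : Integrable F (μ.prod P) :=
      Integrable.of_bound hF.aestronglyMeasurable C (ae_of_all _ hFC)
    have hintE : Integrable (fun p => Real.exp (t * F p)) (μ.prod P) := by
      refine Integrable.of_bound (by fun_prop) (Real.exp (|t| * C)) (ae_of_all _ fun p => ?_)
      rw [Real.norm_eq_abs, Real.abs_exp]
      refine Real.exp_le_exp.2 ((le_abs_self _).trans ?_)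
      rw [abs_mul]
      exact mul_le_mul_of_nonneg_left (hFC p) (abs_nonneg t)
    let g : (Fin N → Z) → ℝ := fun S => ∫ z, F (z, S) ∂μ
    have hg : Measurable g := hF.stronglyMeasurable.integral_prod_left'.measurable
    have hsec : ∀ S, Measurable fun z => F (z, S) := fun S => hF.comp measurable_prodMk_right
    have hsecI : ∀ S, Integrable (fun z => F (z, S)) μ := fun S =>
      Integrable.of_bound (hsec S).aestronglyMeasurable C (ae_of_all _ fun z => hFC _)
    have hgC : ∀ S, |g S| ≤ C := fun S => by
      simpa using norm_integral_le_of_norm_le_const (μ := μ) 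
        (ae_of_all _ (show ∀ z, ‖F (z, S)‖ ≤ C from fun z => hFC (z, S)))
    have hgd : ∀ S s z, |g (Function.update S s z) - g S| ≤ c := fun S s z => by
      rw [← integral_sub (hsecI _) (hsecI _)]
      have : ∀ w, ‖F (w, Function.update S s z) - F (w, S)‖ ≤ c := fun w => by
        rw [hFcons, hFcons, Fin.cons_update]
        exact hd _ _ _
      simpa using norm_integral_le_of_norm_le_const (μ := μ) (ae_of_all _ this)
    -- Hoeffding's lemma for the first coordinate, on the interval of length `2 * c` around the value
    -- at an arbitrary point
    have hstep : ∀ S, ∫ z, Real.exp (t * F (z, S)) ∂μ ≤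
        Real.exp (t * g S) * Real.exp (c ^ 2 * t ^ 2 / 2) := fun S => by
      obtain ⟨z₀⟩ : Nonempty Z := μ.nonempty_of_neZero
      have hmem : ∀ z, F (z, S) ∈ Set.Icc (F (z₀, S) - c) (F (z₀, S) + c) := fun z => by
        have h := hd (Fin.cons z₀ S) 0 z
        rw [Fin.update_cons_zero, ← hFcons, ← hFcons, abs_le] at h
        constructor <;> linarith
      have h := (ProbabilityTheory.hasSubgaussianMGF_of_mem_Icc (hsec S).aemeasurable
        (ae_of_all μ hmem)).mgf_le t
      have h2 : ((‖F (z₀, S) + c - (F (z₀, S) - c)‖₊ / 2) ^ 2 : NNReal) = c ^ 2 := by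
        push_cast
        rw [show F (z₀, S) + c - (F (z₀, S) - c) = 2 * c by ring, Real.norm_eq_abs, div_pow, sq_abs]
        ring
      rw [h2] at h
      have h3 : ∀ z, Real.exp (t * F (z, S)) =
          Real.exp (t * g S) * Real.exp (t * (F (z, S) - g S)) := fun z => by
        rw [← Real.exp_add]; ring_nf
      simp_rw [h3]
      rw [integral_const_mul]
      exact mul_le_mul_of_nonneg_left h (Real.exp_pos _).le
    rw [h1, h1, integral_prod_symm _ hintE, integral_prod_symm _ hintF]
    calc ∫ S, ∫ z, Real.exp (t * F (z, S)) ∂μ ∂P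
        ≤ ∫ S, Real.exp (t * g S) * Real.exp (c ^ 2 * t ^ 2 / 2) ∂P := by
          refine integral_mono hintE.integral_prod_right ?_ hstep
          refine Integrable.mul_const (Integrable.of_bound (by fun_prop) (Real.exp (|t| * C))
            (ae_of_all _ fun S => ?_)) _
          rw [Real.norm_eq_abs, Real.abs_exp]
          refine Real.exp_le_exp.2 ((le_abs_self _).trans ?_)
          rw [abs_mul]
          exact mul_le_mul_of_nonneg_left (hgC S) (abs_nonneg t)
      _ ≤ Real.exp (t * ∫ S, g S ∂P + N * (c ^ 2 * t ^ 2 / 2)) *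
            Real.exp (c ^ 2 * t ^ 2 / 2) := by
          rw [integral_mul_const]
          exact mul_le_mul_of_nonneg_right (ih g hg hgC hgd) (Real.exp_pos _).le
      _ = _ := by
          rw [← Real.exp_add]
          congr 1
          push_cast
          ring

/-- The bounded differences (McDiarmid) inequality. The exponent is a quarter of the optimal
`-2 ε² / (N c²)`. -/
theorem measureReal_le_of_bounded_differences {Z : Type*} [MeasurableSpace Z]
    (μ : Measure Z) [IsProbabilityMeasure μ] {N : ℕ} (hN : 0 < N) {c C ε : ℝ}
    (hc : 0 < c) (hε : 0 ≤ ε)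
    (f : (Fin N → Z) → ℝ) (hf : Measurable f) (hC : ∀ S, |f S| ≤ C)
    (hd : ∀ S s z, |f (Function.update S s z) - f S| ≤ c) :
    (Measure.pi fun _ : Fin N => μ).real
        {S | ∫ S', f S' ∂(Measure.pi fun _ : Fin N => μ) + ε ≤ f S} ≤
      Real.exp (-(ε ^ 2 / (2 * N * c ^ 2))) := by
  set P := Measure.pi fun _ : Fin N => μ
  set m := ∫ S', f S' ∂P
  have hNR : (0 : ℝ) < N := by exact_mod_cast hN
  -- the minimizer of `N c² t² / 2 - t ε`
  let t : ℝ := ε / (N * c ^ 2)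
  have ht : 0 ≤ t := by positivity
  have hint : Integrable (fun S => Real.exp (t * f S)) P := by
    refine Integrable.of_bound (by fun_prop) (Real.exp (|t| * C)) (ae_of_all _ fun S => ?_)
    rw [Real.norm_eq_abs, Real.abs_exp]
    refine Real.exp_le_exp.2 ((le_abs_self _).trans ?_)
    rw [abs_mul]
    exact mul_le_mul_of_nonneg_left (hC S) (abs_nonneg t)
  have h := ProbabilityTheory.measure_ge_le_exp_mul_mgf (μ := P) (X := f) (m + ε) ht hint
  refine h.trans ?_
  have h2 := integral_exp_le_of_bounded_differences μ (c := c) t N f hf hC hd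
  refine (mul_le_mul_of_nonneg_left h2 (Real.exp_pos _).le).trans ?_
  rw [← Real.exp_add]
  refine Real.exp_le_exp.2 (le_of_eq ?_)
  simp only [t]
  field_simp
  ring

/-! ### Contraction for Rademacher averages -/

theorem expect_finCons {Ω : Type*} [Fintype Ω] {N : ℕ} (G : (Fin (N + 1) → Ω) → ℝ) :
    Finset.expect Finset.univ G =
      Finset.expect Finset.univ fun w₀ : Ω =>
        Finset.expect Finset.univ fun w : Fin N → Ω => G (Fin.cons w₀ w) := by
  rw [← Finset.expect_product', Finset.univ_product_univ]
  exact (Fintype.expect_equiv (Fin.consEquiv fun _ => Ω) _ _ fun _ => rfl).symm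

theorem expect_units (g : ℤˣ → ℝ) : Finset.expect Finset.univ g = (g 1 + g (-1)) / 2 := by
  rw [Fintype.expect_eq_sum_div_card]
  simp

/-- Contraction for a single random sign: the sign times `f` may be replaced by the sign times the
coordinate `a k`, for `k` uniformly random, scaled by the number of coordinates. The scaling is the
price for `∑ k, |v k|` being an average over `k`. -/
theorem iSup_add_iSup_le_expect {κ T : Type*} [Fintype κ] [Nonempty κ] [Nonempty T]
    {c f : T → ℝ} {a : κ → T → ℝ} (hc : ∃ C, ∀ t, |c t| ≤ C)
    (ha : ∃ C, ∀ k t, |a k t| ≤ C)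
    (hfa : ∀ t t', f t - f t' ≤ ∑ k, |a k t - a k t'|) :
    (⨆ t, (c t + f t)) + (⨆ t, (c t - f t)) ≤
      Finset.expect Finset.univ fun k : κ =>
        (⨆ t, (c t + (Fintype.card κ : ℝ) * a k t)) + (⨆ t, (c t - (Fintype.card κ : ℝ) * a k t)) := by
  obtain ⟨C, hC⟩ := hc
  obtain ⟨D, hD⟩ := ha
  set d : ℝ := (Fintype.card κ : ℝ)
  have hd : 0 ≤ d := Nat.cast_nonneg _
  have hdD : ∀ k t, |d * a k t| ≤ d * D := fun k t => by
    rw [abs_mul, abs_of_nonneg hd]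
    exact mul_le_mul_of_nonneg_left (hD k t) hd
  have hb1 : ∀ k, BddAbove (Set.range fun t => c t + d * a k t) := fun k => by
    refine ⟨C + d * D, ?_⟩
    rintro _ ⟨t, rfl⟩
    exact add_le_add ((le_abs_self _).trans (hC t)) ((le_abs_self _).trans (hdD k t))
  have hb2 : ∀ k, BddAbove (Set.range fun t => c t - d * a k t) := fun k => by
    refine ⟨C + d * D, ?_⟩
    rintro _ ⟨t, rfl⟩
    have h1 := (le_abs_self _).trans (hC t)
    have h2 := (abs_le.1 (hdD k t)).1
    change c t - d * a k t ≤ _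
    linarith
  set M := Finset.expect Finset.univ fun k : κ =>
        (⨆ t, (c t + d * a k t)) + (⨆ t, (c t - d * a k t)) with hM
  have key : ∀ t t', (c t + f t) + (c t' - f t') ≤ M := fun t t' => by
    have h1 : ∑ k, |a k t - a k t'| =
        Finset.expect Finset.univ fun k : κ => d * |a k t - a k t'| := by
      rw [← Finset.mul_expect, Fintype.expect_eq_sum_div_card]
      have : d ≠ 0 := by simp [d]
      field_simp
      rfl
    have h2 : (c t + f t) + (c t' - f t') ≤
        Finset.expect Finset.univ fun k : κ => (c t + c t') + d * |a k t - a k t'| := by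
      rw [Finset.expect_add_distrib, Fintype.expect_const, ← h1]
      linarith [hfa t t']
    refine h2.trans (Finset.expect_le_expect fun k _ => ?_)
    have e1 := le_ciSup (hb1 k) t
    have e2 := le_ciSup (hb2 k) t'
    have e3 := le_ciSup (hb1 k) t'
    have e4 := le_ciSup (hb2 k) t
    rcases abs_cases (a k t - a k t') with ⟨h, _⟩ | ⟨h, _⟩ <;> rw [h] <;> linarith
  have h1 : ⨆ t, (c t + f t) ≤ M - ⨆ t, (c t - f t) := by
    refine ciSup_le fun t => ?_
    have : ⨆ t, (c t - f t) ≤ M - (c t + f t) := ciSup_le fun t' => by linarith [key t t']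
    linarith
  linarith

/-- Vector-valued contraction: if each `f s` is `1`-Lipschitz for the `ℓ¹` distance of the
coordinates `a s k`, then in a Rademacher average it may be replaced by a signed coordinate chosen
uniformly at random, independently for each `s`, and scaled by the number of coordinates. -/
theorem expect_iSup_le_contraction {κ T : Type*} [Fintype κ] [Nonempty κ] [Nonempty T] :
    ∀ (N : ℕ) {c : T → ℝ} {f : Fin N → T → ℝ} {a : Fin N → κ → T → ℝ},
      (∃ C, ∀ t, |c t| ≤ C) → (∃ C, ∀ s t, |f s t| ≤ C) → (∃ C, ∀ s k t, |a s k t| ≤ C) →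
      (∀ s t t', f s t - f s t' ≤ ∑ k, |a s k t - a s k t'|) →
      (Finset.expect Finset.univ fun σ : Fin N → ℤˣ =>
          ⨆ t, (c t + ∑ s, ((σ s : ℤ) : ℝ) * f s t)) ≤
        Finset.expect Finset.univ fun w : Fin N → κ × ℤˣ =>
          ⨆ t, (c t + ∑ s, (Fintype.card κ : ℝ) * (((w s).2 : ℤ) : ℝ) * a s (w s).1 t) := by
  intro N
  induction N with
  | zero => intros; simp
  | succ N ih =>
    intro c f a hc hf ha hfa
    set d : ℝ := (Fintype.card κ : ℝ) with hd
    obtain ⟨C, hC⟩ := hc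
    obtain ⟨F, hF⟩ := hf
    obtain ⟨D, hD⟩ := ha
    have hσ : ∀ (u : ℤˣ) (x : ℝ), |((u : ℤ) : ℝ) * x| = |x| := fun u x => by
      rcases Int.units_eq_one_or u with rfl | rfl <;> simp
    rw [expect_finCons, expect_finCons]
    calc _ ≤ Finset.expect Finset.univ fun σ₀ : ℤˣ =>
            Finset.expect Finset.univ fun w : Fin N → κ × ℤˣ =>
              ⨆ t, ((c t + ((σ₀ : ℤ) : ℝ) * f 0 t) +
                ∑ s : Fin N, d * (((w s).2 : ℤ) : ℝ) * a s.succ (w s).1 t) := by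
          refine Finset.expect_le_expect fun σ₀ _ => ?_
          have := ih (c := fun t => c t + ((σ₀ : ℤ) : ℝ) * f 0 t) (f := fun s => f s.succ)
            (a := fun s => a s.succ)
            ⟨C + F, fun t => (abs_add_le _ _).trans (add_le_add (hC t) (by
              rw [hσ]; exact hF 0 t))⟩ ⟨F, fun s => hF s.succ⟩ ⟨D, fun s => hD s.succ⟩
            (fun s => hfa s.succ)
          simpa only [Fin.sum_univ_succ, Fin.cons_zero, Fin.cons_succ, add_assoc] using this
      _ = Finset.expect Finset.univ fun w : Fin N → κ × ℤˣ =>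
            Finset.expect Finset.univ fun σ₀ : ℤˣ =>
              ⨆ t, ((c t + ∑ s : Fin N, d * (((w s).2 : ℤ) : ℝ) * a s.succ (w s).1 t) +
                ((σ₀ : ℤ) : ℝ) * f 0 t) := by
          rw [Finset.expect_comm]
          simp only [add_right_comm]
      _ ≤ Finset.expect Finset.univ fun w : Fin N → κ × ℤˣ =>
            Finset.expect Finset.univ fun w₀ : κ × ℤˣ =>
              ⨆ t, ((c t + ∑ s : Fin N, d * (((w s).2 : ℤ) : ℝ) * a s.succ (w s).1 t) +
                d * ((w₀.2 : ℤ) : ℝ) * a 0 w₀.1 t) := by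
          refine Finset.expect_le_expect fun w _ => ?_
          rw [expect_units, ← Finset.univ_product_univ, Finset.expect_product]
          simp only [expect_units]
          rw [← Finset.expect_div]
          refine div_le_div_of_nonneg_right ?_ zero_le_two
          have := iSup_add_iSup_le_expect (f := f 0) (a := a 0)
            (c := fun t => c t + ∑ s : Fin N, d * (((w s).2 : ℤ) : ℝ) * a s.succ (w s).1 t)
            ⟨C + ∑ s : Fin N, d * D, fun t => (abs_add_le _ _).trans (add_le_add (hC t)
              ((Finset.abs_sum_le_sum_abs _ _).trans (Finset.sum_le_sum fun s _ => by
                rw [mul_assoc, abs_mul, hσ, abs_of_nonneg (Nat.cast_nonneg _)]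
                exact mul_le_mul_of_nonneg_left (hD _ _ _) (Nat.cast_nonneg _))))⟩
            ⟨D, hD 0⟩ (hfa 0)
          simpa [sub_eq_add_neg, hd] using this
      _ = _ := by
          rw [Finset.expect_comm]
          simp only [Fin.sum_univ_succ, Fin.cons_zero, Fin.cons_succ, add_assoc,
            add_comm (∑ s : Fin N, d * _ * _)]

/-- The second moment of a weighted sum of independent copies of the centred variable `ξ` on the
uniform probability space `Ω`. -/
theorem expect_sum_mul_sq {Ω : Type*} [Fintype Ω] [Nonempty Ω] {ξ : Ω → ℝ}
    (hξ : Finset.expect Finset.univ ξ = 0) :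
    ∀ (N : ℕ) (u : Fin N → ℝ),
      (Finset.expect Finset.univ fun w : Fin N → Ω => (∑ s, ξ (w s) * u s) ^ 2) =
        (Finset.expect Finset.univ fun ω => ξ ω ^ 2) * ∑ s, u s ^ 2 := by
  intro N
  induction N with
  | zero => intro u; simp
  | succ N ih =>
    intro u
    rw [expect_finCons]
    have h : ∀ (w₀ : Ω) (w : Fin N → Ω),
        (∑ s, ξ ((Fin.cons w₀ w : Fin (N + 1) → Ω) s) * u s) ^ 2 =
          ξ w₀ ^ 2 * u 0 ^ 2 + ξ w₀ * (2 * u 0 * ∑ s : Fin N, ξ (w s) * u s.succ) +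
            (∑ s : Fin N, ξ (w s) * u s.succ) ^ 2 := fun w₀ w => by
      rw [Fin.sum_univ_succ]
      simp only [Fin.cons_zero, Fin.cons_succ]
      ring
    refine (Finset.expect_congr rfl fun w₀ _ =>
      Finset.expect_congr rfl fun w _ => h w₀ w).trans ?_
    simp only [Finset.expect_add_distrib, Fintype.expect_const, ih fun s => u s.succ,
      ← Finset.mul_expect, ← Finset.expect_mul, hξ, Fin.sum_univ_succ]
    ring

/-! ### Rademacher averages of linear classes -/

/-- If for every `k` the vectors `(a s k t)_s` lie in a subspace `W` of dimension at most `p`, then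
only the projections to `W` of the random vectors they are paired with matter, and the projection of
a random vector with uncorrelated coordinates has second moment proportional to `p`. -/
theorem expect_iSup_linear_le {κ T : Type*} [Fintype κ] [Nonempty κ] [DecidableEq κ] [Nonempty T]
    {N p : ℕ} {R : ℝ} (hR : 0 ≤ R) (hp : 0 < p) (W : Submodule ℝ (EuclideanSpace ℝ (Fin N)))
    (hW : Module.finrank ℝ W ≤ p) (a : Fin N → κ → T → ℝ)
    (haW : ∀ k t, WithLp.toLp 2 (fun s => a s k t) ∈ W)
    (haR : ∀ s t, ∑ k, a s k t ^ 2 ≤ R ^ 2) :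
    (Finset.expect Finset.univ fun w : Fin N → κ × ℤˣ =>
        ⨆ t, ∑ s, (Fintype.card κ : ℝ) * (((w s).2 : ℤ) : ℝ) * a s (w s).1 t) ≤
      Fintype.card κ * √p * (√N * R) := by
  set d : ℝ := (Fintype.card κ : ℝ) with hd
  have hd0 : 0 < d := by simp [hd, Fintype.card_pos]
  have hp0 : (0 : ℝ) < p := by exact_mod_cast hp
  let b := stdOrthonormalBasis ℝ W
  let ι := Fin (Module.finrank ℝ W)
  -- the `k`-th coordinate of the random vector attached to one sample point
  let ξ : κ → κ × ℤˣ → ℝ := fun k v => if v.1 = k then d * ((v.2 : ℤ) : ℝ) else 0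
  let u : ι → Fin N → ℝ := fun j s => (b j : EuclideanSpace ℝ (Fin N)) s
  -- the squared norm of the projections to `W` of the random vectors `(ξ k (w s))_s`
  let Q : (Fin N → κ × ℤˣ) → ℝ := fun w => ∑ k, ∑ j, (∑ s, ξ k (w s) * u j s) ^ 2
  have hξ0 : ∀ k, Finset.expect Finset.univ (ξ k) = 0 := fun k => by
    rw [← Finset.univ_product_univ, Finset.expect_product]
    refine Finset.expect_eq_zero fun i _ => ?_
    rw [expect_units]
    by_cases h : i = k <;> simp [h]
  have hξ2 : ∀ k, (Finset.expect Finset.univ fun v => ξ k v ^ 2) = d := fun k => by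
    rw [← Finset.univ_product_univ, Finset.expect_product, Fintype.expect_eq_sum_div_card]
    simp only [ξ, expect_units]
    have : ∀ i : κ, ((if i = k then d * (((1 : ℤˣ) : ℤ) : ℝ) else 0) ^ 2 +
        (if i = k then d * (((-1 : ℤˣ) : ℤ) : ℝ) else 0) ^ 2) / 2 = if i = k then d ^ 2 else 0 := by
      intro i; split_ifs <;> simp
    simp only [this, Finset.sum_ite_eq', Finset.mem_univ, if_true]
    rw [← hd]
    field_simp
  have hunorm : ∀ j, ∑ s, u j s ^ 2 = 1 := fun j => by
    have h := b.orthonormal.1 j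
    have h2 : ‖(b j : EuclideanSpace ℝ (Fin N))‖ ^ 2 = 1 := by
      rw [show ‖(b j : EuclideanSpace ℝ (Fin N))‖ = 1 from h, one_pow]
    rw [EuclideanSpace.norm_sq_eq] at h2
    simpa [u] using h2
  have hQ : Finset.expect Finset.univ Q ≤ d ^ 2 * p := by
    have h : Finset.expect Finset.univ Q = d * d * Module.finrank ℝ W := by
      simp only [Q, Finset.expect_sum_comm]
      simp only [expect_sum_mul_sq (hξ0 _), hξ2, hunorm]
      simp [ι, hd]
      ring
    rw [h]
    have : (Module.finrank ℝ W : ℝ) ≤ p := by exact_mod_cast hW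
    nlinarith [mul_le_mul_of_nonneg_left this (mul_self_nonneg d)]
  have hpt : ∀ w t, ∑ s, d * (((w s).2 : ℤ) : ℝ) * a s (w s).1 t ≤ √N * R * √(Q w) := by
    intro w t
    let v : κ → W := fun k => ⟨_, haW k t⟩
    have hinner : ∀ (x : EuclideanSpace ℝ (Fin N)) (y : W),
        inner ℝ (y : EuclideanSpace ℝ (Fin N)) x = ∑ j, inner ℝ y (b j) *
          inner ℝ (b j : EuclideanSpace ℝ (Fin N)) x := fun x y => by
      conv_lhs => rw [← b.sum_repr y]
      rw [Submodule.coe_sum, sum_inner]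
      refine Finset.sum_congr rfl fun j _ => ?_
      rw [Submodule.coe_smul, real_inner_smul_left, b.repr_apply_apply, real_inner_comm]
    have h1 : ∑ s, d * (((w s).2 : ℤ) : ℝ) * a s (w s).1 t = ∑ k, ∑ s, a s k t * ξ k (w s) := by
      rw [Finset.sum_comm]
      refine Finset.sum_congr rfl fun s _ => ?_
      simp [ξ, mul_comm]
    have h2 : ∀ k, ∑ s, a s k t * ξ k (w s) =
        ∑ j, inner ℝ (v k) (b j) * ∑ s, ξ k (w s) * u j s := fun k => by
      have := hinner (WithLp.toLp 2 fun s => ξ k (w s)) (v k)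
      simpa [v, PiLp.inner_apply, u, mul_comm] using this
    have h3 : ∑ k, ∑ j, inner ℝ (v k) (b j) ^ 2 ≤ N * R ^ 2 := by
      have : ∀ k, ∑ j, inner ℝ (v k) (b j) ^ 2 = ∑ s, a s k t ^ 2 := fun k => by
        have e1 := b.sum_sq_inner_left (v k)
        have e2 : ‖v k‖ ^ 2 = ∑ s, a s k t ^ 2 := by
          rw [Submodule.coe_norm, EuclideanSpace.norm_sq_eq]
          simp [v]
        rw [← e2, ← e1]
      simp only [this]
      rw [Finset.sum_comm]
      calc _ ≤ ∑ s : Fin N, R ^ 2 := Finset.sum_le_sum fun s _ => haR s t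
        _ = _ := by simp
    rw [h1]
    simp only [h2]
    rw [← Finset.univ.sum_product', Finset.univ_product_univ]
    refine (Real.sum_mul_le_sqrt_mul_sqrt _ _ _).trans ?_
    have h4 : √N * R = √(N * R ^ 2) := by
      rw [Real.sqrt_mul (Nat.cast_nonneg _), Real.sqrt_sq hR]
    rw [h4]
    refine mul_le_mul (Real.sqrt_le_sqrt ?_) (Real.sqrt_le_sqrt (le_of_eq ?_))
      (Real.sqrt_nonneg _) (Real.sqrt_nonneg _)
    · rw [← Finset.univ_product_univ, Finset.sum_product]
      exact h3
    · rw [← Finset.univ_product_univ, Finset.sum_product]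
  -- Jensen's inequality for the square root, in the form `√Q ≤ (Q / q + q) / 2`
  set q := d * √p with hq
  have hq0 : 0 < q := by positivity
  have hq2 : q ^ 2 = d ^ 2 * p := by rw [hq, mul_pow, Real.sq_sqrt hp0.le]
  have hQ0 : ∀ w, 0 ≤ Q w := fun w =>
    Finset.sum_nonneg fun k _ => Finset.sum_nonneg fun j _ => sq_nonneg _
  calc _ ≤ Finset.expect Finset.univ fun w => √N * R * ((Q w / q + q) / 2) := by
        refine Finset.expect_le_expect fun w _ => ciSup_le fun t => (hpt w t).trans ?_
        refine mul_le_mul_of_nonneg_left ?_ (by positivity)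
        have h5 : Q w / q = √(Q w) ^ 2 / q := by rw [Real.sq_sqrt (hQ0 w)]
        rw [h5, le_div_iff₀ two_pos, ← sub_nonneg]
        have : √(Q w) ^ 2 / q + q - √(Q w) * 2 = (√(Q w) - q) ^ 2 / q := by
          field_simp
          ring
        rw [this]
        positivity
    _ = √N * R * ((Finset.expect Finset.univ Q / q + q) / 2) := by
        rw [← Finset.mul_expect, ← Finset.expect_div, Finset.expect_add_distrib,
          ← Finset.expect_div, Fintype.expect_const]
    _ ≤ √N * R * ((q ^ 2 / q + q) / 2) := by
        rw [hq2]
        gcongr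
    _ = q * (√N * R) := by
        field_simp
        ring

/-- Bound for the Rademacher average of the norm loss over linear maps that send the inputs into the
ball of radius `R`. Apart from `R` it depends on the dimensions only. The bound `B` on the loss makes
the suprema meaningful. -/
theorem expect_iSup_norm_sub_le {κ T E F : Type*} [Fintype κ] [Nonempty κ] [Nonempty T]
    [AddCommGroup E] [Module ℝ E] [FiniteDimensional ℝ E] [NormedAddCommGroup F] [Module ℝ F]
    {N p : ℕ} {R B : ℝ} (hR : 0 ≤ R) (hp : 0 < p) (hE : Module.finrank ℝ E ≤ p)
    (e : κ → F →ₗ[ℝ] ℝ) (he₁ : ∀ v, ‖v‖ ≤ ∑ k, |e k v|) (he₂ : ∀ v, ∑ k, e k v ^ 2 ≤ ‖v‖ ^ 2)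
    (A : T → E →ₗ[ℝ] F) (x : Fin N → E) (y : Fin N → F)
    (hA : ∀ t s, ‖A t (x s)‖ ≤ R) (hB : ∀ t s, ‖A t (x s) - y s‖ ≤ B) :
    (Finset.expect Finset.univ fun σ : Fin N → ℤˣ =>
        ⨆ t, ∑ s, ((σ s : ℤ) : ℝ) * ‖A t (x s) - y s‖) ≤
      Fintype.card κ * √p * (√N * R) := by
  classical
  have haR : ∀ s t, ∑ k, e k (A t (x s)) ^ 2 ≤ R ^ 2 := fun s t =>
    (he₂ _).trans (pow_le_pow_left₀ (norm_nonneg _) (hA t s) 2)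
  -- all the vectors of coordinates `(e k (A t (x s)))_s` lie in the space of the vectors
  -- `(ℓ (x s))_s`, where `ℓ` runs over the dual of `E`
  let ev : Module.Dual ℝ E →ₗ[ℝ] EuclideanSpace ℝ (Fin N) :=
    { toFun := fun ℓ => WithLp.toLp 2 fun s => ℓ (x s)
      map_add' := fun _ _ => rfl
      map_smul' := fun _ _ => rfl }
  have hW : Module.finrank ℝ (LinearMap.range ev) ≤ p :=
    (LinearMap.finrank_range_le ev).trans (by rwa [Subspace.dual_finrank_eq])
  have h1 := expect_iSup_le_contraction N (c := fun _ : T => 0)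
    (f := fun s t => ‖A t (x s) - y s‖) (a := fun s k t => e k (A t (x s)))
    ⟨0, by simp⟩ ⟨B, fun s t => by rw [abs_norm]; exact hB t s⟩
    ⟨R, fun s k t => abs_le_of_sq_le_sq
      ((Finset.single_le_sum (fun k _ => sq_nonneg (e k (A t (x s)))) (Finset.mem_univ k)).trans
        (haR s t)) hR⟩
    (fun s t t' => by
      refine (norm_sub_norm_le _ _).trans ?_
      rw [sub_sub_sub_cancel_right]
      refine (he₁ _).trans (le_of_eq ?_)
      simp only [map_sub])
  simp only [zero_add] at h1
  refine h1.trans ?_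
  exact expect_iSup_linear_le hR hp (LinearMap.range ev) hW (fun s k t => e k (A t (x s)))
    (fun k t => ⟨(e k).comp (A t), rfl⟩) haR

/-! ### Symmetrization -/

/-- Exchanging the two members of each pair at the places where `σ` is negative preserves the law of
`N` independent pairs of independent variables of the same law. -/
theorem measurePreserving_signSwap {Z : Type*} [MeasurableSpace Z] (μ : Measure Z)
    [IsProbabilityMeasure μ] {N : ℕ} (σ : Fin N → ℤˣ) :
    MeasurePreserving (fun (q : Fin N → Z × Z) s => if σ s = 1 then q s else (q s).swap)
      (Measure.pi fun _ => μ.prod μ) (Measure.pi fun _ => μ.prod μ) := by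
  refine measurePreserving_pi (fun _ => μ.prod μ) (fun _ => μ.prod μ)
    (f := fun s p => if σ s = 1 then p else p.swap) fun s => ?_
  by_cases h : σ s = 1
  · simp only [h, if_true]
    exact MeasurePreserving.id (μ.prod μ)
  · simpa [h] using Measure.measurePreserving_swap (μ := μ) (ν := μ)

/-- Symmetrization: the mean of the largest deviation of the sample sums from their expectations is
at most twice any bound for the Rademacher averages. -/
theorem integral_iSup_le_of_expect_le {Z T : Type*} [MeasurableSpace Z] [Countable T] [Nonempty T]
    (μ : Measure Z) [IsProbabilityMeasure μ] {N : ℕ} {B K : ℝ} (f : T → Z → ℝ)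
    (hf : ∀ t, Measurable (f t)) (hB : ∀ t z, |f t z| ≤ B)
    (hK : ∀ S : Fin N → Z, (Finset.expect Finset.univ fun σ : Fin N → ℤˣ =>
      ⨆ t, ∑ s, ((σ s : ℤ) : ℝ) * f t (S s)) ≤ K) :
    ∫ S, (⨆ t, ∑ s, (∫ z, f t z ∂μ - f t (S s))) ∂(Measure.pi fun _ : Fin N => μ) ≤ 2 * K := by
  set P := Measure.pi fun _ : Fin N => μ
  have hL : ∀ t, |∫ z, f t z ∂μ| ≤ B := fun t => by
    simpa using norm_integral_le_of_norm_le_const (μ := μ) (ae_of_all _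
      (show ∀ z, ‖f t z‖ ≤ B from hB t))
  -- a supremum of sums of terms of absolute value at most `b` has absolute value at most `N * b`
  have hsum : ∀ {b : ℝ} {g : T → Fin N → ℝ}, (∀ t s, |g t s| ≤ b) →
      ∀ t, |∑ s, g t s| ≤ N * b := fun {b g} hg t =>
    (Finset.abs_sum_le_sum_abs _ _).trans
      ((Finset.sum_le_sum fun s _ => hg t s).trans (by simp))
  have hbdd : ∀ {b : ℝ} {g : T → Fin N → ℝ}, (∀ t s, |g t s| ≤ b) →
      BddAbove (Set.range fun t => ∑ s, g t s) := fun {b g} hg => by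
    refine ⟨N * b, ?_⟩
    rintro _ ⟨t, rfl⟩
    exact (le_abs_self _).trans (hsum hg t)
  have habs : ∀ {b : ℝ} {g : T → Fin N → ℝ}, (∀ t s, |g t s| ≤ b) →
      |⨆ t, ∑ s, g t s| ≤ N * b := fun {b g} hg => by
    let t₀ := Classical.arbitrary T
    rw [abs_le]
    exact ⟨(abs_le.1 (hsum hg t₀)).1.trans (le_ciSup (hbdd hg) t₀),
      ciSup_le fun t => (le_abs_self _).trans (hsum hg t)⟩
  have hdiff : ∀ (t : T) (p : Z × Z), |f t p.2 - f t p.1| ≤ 2 * B := fun t p => by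
    have := abs_sub (f t p.2) (f t p.1)
    linarith [hB t p.1, hB t p.2]
  let D : (Fin N → Z × Z) → ℝ := fun q => ⨆ t, ∑ s, (f t (q s).2 - f t (q s).1)
  have hDm : Measurable D := Measurable.iSup fun t => by
    refine Finset.measurable_sum _ fun s _ => ?_
    have h1 := hf t
    fun_prop
  have hDb : ∀ q, |D q| ≤ N * (2 * B) := fun q => habs fun t s => hdiff t (q s)
  let D₂ : (Fin N → Z) × (Fin N → Z) → ℝ := fun x => D fun s => (x.1 s, x.2 s)
  have hD₂m : Measurable D₂ := hDm.comp (by fun_prop)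
  have hD₂I : Integrable D₂ (P.prod P) :=
    Integrable.of_bound hD₂m.aestronglyMeasurable _ (ae_of_all _ fun x => hDb _)
  -- replace the expectation by the average over an independent copy of the sample
  have hghost : ∫ S, (⨆ t, ∑ s, (∫ z, f t z ∂μ - f t (S s))) ∂P ≤ ∫ S, ∫ S', D₂ (S, S') ∂P ∂P := by
    refine integral_mono ?_ hD₂I.integral_prod_left ?_
    · refine Integrable.of_bound (Measurable.aestronglyMeasurable ?_) (N * (2 * B))
        (ae_of_all _ fun S => habs fun t s => ?_)
      · refine Measurable.iSup fun t => Finset.measurable_sum _ fun s _ => ?_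
        have h1 := hf t
        fun_prop
      · have := abs_sub (∫ z, f t z ∂μ) (f t (S s))
        linarith [hB t (S s), hL t]
    · intro S
      refine ciSup_le fun t => ?_
      have hcomp : ∀ s : Fin N, Integrable (fun S' : Fin N → Z => f t (S' s)) P := fun s =>
        Integrable.of_bound ((hf t).comp (measurable_pi_apply s)).aestronglyMeasurable B
          (ae_of_all _ fun S' => hB t _)
      have hsub : ∀ s : Fin N, Integrable (fun S' : Fin N → Z => f t (S' s) - f t (S s)) P :=
        fun s => (hcomp s).sub (integrable_const _)
      have h1 : ∑ s, (∫ z, f t z ∂μ - f t (S s)) =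
          ∫ S', ∑ s, (f t (S' s) - f t (S s)) ∂P := by
        rw [integral_finsetSum _ fun s _ => hsub s]
        refine Finset.sum_congr rfl fun s _ => ?_
        rw [integral_sub (hcomp s) (integrable_const _), integral_const]
        have := integral_comp_eval (μ := fun _ : Fin N => μ) (i := s)
          (hf t).aestronglyMeasurable
        simp only [P, this]
        simp
      rw [h1]
      refine integral_mono (integrable_finsetSum _ fun s _ => hsub s)
        (Integrable.of_bound (hD₂m.comp measurable_prodMk_left).aestronglyMeasurable _
          (ae_of_all _ fun S' => hDb _)) fun S' => ?_
      exact le_ciSup (hbdd (g := fun t s => f t (S' s) - f t (S s))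
        fun t s => hdiff t (S s, S' s)) t
  refine hghost.trans ?_
  have hpair : ∫ S, ∫ S', D₂ (S, S') ∂P ∂P = ∫ q, D q ∂(Measure.pi fun _ => μ.prod μ) := by
    rw [← integral_prod _ hD₂I]
    exact ((measurePreserving_arrowProdEquivProdArrow Z Z (Fin N) (fun _ => μ)
      (fun _ => μ)).integral_comp' (g := D₂)).symm
  rw [hpair]
  -- exchanging the two samples at the places where the sign is negative changes nothing
  let τ : (Fin N → ℤˣ) → (Fin N → Z × Z) → (Fin N → Z × Z) :=
    fun σ q s => if σ s = 1 then q s else (q s).swap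
  have hτ : ∀ σ, ∫ q, D (τ σ q) ∂(Measure.pi fun _ => μ.prod μ) =
      ∫ q, D q ∂(Measure.pi fun _ => μ.prod μ) := fun σ => by
    have h := measurePreserving_signSwap μ σ
    conv_rhs => rw [← h.map_eq]
    exact (integral_map h.measurable.aemeasurable hDm.aestronglyMeasurable).symm
  have hτI : ∀ σ, Integrable (fun q => D (τ σ q)) (Measure.pi fun _ => μ.prod μ) := fun σ =>
    Integrable.of_bound (hDm.comp (measurePreserving_signSwap μ σ).measurable).aestronglyMeasurable
      _ (ae_of_all _ fun q => hDb _)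
  have havg : ∫ q, D q ∂(Measure.pi fun _ => μ.prod μ) =
      ∫ q, (Finset.expect Finset.univ fun σ => D (τ σ q)) ∂(Measure.pi fun _ => μ.prod μ) := by
    simp only [Fintype.expect_eq_sum_div_card]
    rw [integral_div, integral_finsetSum _ fun σ _ => hτI σ]
    simp only [hτ]
    simp
  rw [havg]
  have hτD : ∀ σ q, D (τ σ q) ≤ (⨆ t, ∑ s, ((σ s : ℤ) : ℝ) * f t (q s).2) +
      ⨆ t, ∑ s, (((-σ) s : ℤ) : ℝ) * f t (q s).1 := fun σ q => by
    have hb : ∀ (u : ℤˣ) (t : T) (z : Z), |((u : ℤ) : ℝ) * f t z| ≤ B := fun u t z => by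
      rcases Int.units_eq_one_or u with rfl | rfl <;> simpa using hB t z
    refine ciSup_le fun t => ?_
    have h1 := le_ciSup (hbdd (g := fun t s => ((σ s : ℤ) : ℝ) * f t (q s).2)
      fun t s => hb _ _ _) t
    have h2 := le_ciSup (hbdd (g := fun t s => (((-σ) s : ℤ) : ℝ) * f t (q s).1)
      fun t s => hb _ _ _) t
    refine le_trans (le_of_eq ?_) (add_le_add h1 h2)
    rw [← Finset.sum_add_distrib]
    refine Finset.sum_congr rfl fun s _ => ?_
    simp only [τ, Pi.neg_apply]
    rcases Int.units_eq_one_or (σ s) with h | h <;> simp [h] <;> ring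
  have hneg : ∀ q : Fin N → Z × Z,
      (Finset.expect Finset.univ fun σ : Fin N → ℤˣ =>
        ⨆ t, ∑ s, (((-σ) s : ℤ) : ℝ) * f t (q s).1) ≤ K := fun q => by
    refine le_trans (le_of_eq ?_) (hK fun s => (q s).1)
    exact Fintype.expect_equiv (Equiv.neg _) _ _ fun σ => rfl
  have hfin : ∀ q, (Finset.expect Finset.univ fun σ => D (τ σ q)) ≤ 2 * K := fun q => by
    refine (Finset.expect_le_expect fun σ _ => hτD σ q).trans ?_
    rw [Finset.expect_add_distrib]
    linarith [hK fun s => (q s).2, hneg q]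
  calc _ ≤ ∫ _, 2 * K ∂(Measure.pi fun _ : Fin N => μ.prod μ) := by
        refine integral_mono ?_ (integrable_const _) hfin
        simp only [Fintype.expect_eq_sum_div_card]
        exact (integrable_finsetSum _ fun σ _ => hτI σ).div_const _
    _ = 2 * K := by simp

/-! ### Uniform deviation bounds -/

/-- Uniform deviation bound for a loss `f t z` that is continuous in the parameter `t`, from a bound
`K` for the Rademacher averages over countable families of parameters. -/
theorem exists_event_integral_le {Z T : Type*} [MeasurableSpace Z] [TopologicalSpace T]
    [SecondCountableTopology T] [Nonempty T] (μ : Measure Z) [IsProbabilityMeasure μ]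
    {N : ℕ} (hN : 0 < N) {B K δ : ℝ} (hB0 : 0 < B) (hδ : 0 < δ) (hδ' : δ < 1) (f : T → Z → ℝ)
    (hf : ∀ t, Measurable (f t)) (hfc : ∀ z, Continuous fun t => f t z)
    (hf0 : ∀ t z, 0 ≤ f t z) (hB : ∀ t z, f t z ≤ B)
    (hK : ∀ (u : ℕ → T) (S : Fin N → Z), (Finset.expect Finset.univ fun σ : Fin N → ℤˣ =>
      ⨆ i, ∑ s, ((σ s : ℤ) : ℝ) * f (u i) (S s)) ≤ K) :
    ∃ E : Set (Fin N → Z), MeasurableSet E ∧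
      1 - δ ≤ (Measure.pi fun _ : Fin N => μ).real E ∧
      ∀ S ∈ E, ∀ t, ∫ z, f t z ∂μ ≤
        1 / N * ∑ s, f t (S s) + (B * √(2 * N * Real.log δ⁻¹) + 2 * K) / N := by
  set P := Measure.pi fun _ : Fin N => μ
  have hNR : (0 : ℝ) < N := by exact_mod_cast hN
  have habs : ∀ t z, |f t z| ≤ B := fun t z => by rw [abs_of_nonneg (hf0 t z)]; exact hB t z
  have hL0 : ∀ t, 0 ≤ ∫ z, f t z ∂μ := fun t => integral_nonneg (hf0 t)
  have hL : ∀ t, ∫ z, f t z ∂μ ≤ B := fun t => by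
    have := norm_integral_le_of_norm_le_const (μ := μ) (ae_of_all _
      (show ∀ z, ‖f t z‖ ≤ B from habs t))
    simpa using (le_abs_self _).trans this
  -- countably many parameters suffice, which makes the largest deviation `Ψ` measurable
  let u := TopologicalSpace.denseSeq T
  let G : ℕ → (Fin N → Z) → ℝ := fun i S => ∑ s, (∫ z, f (u i) z ∂μ - f (u i) (S s))
  let Ψ : (Fin N → Z) → ℝ := fun S => ⨆ i, G i S
  have hG : ∀ i S, |G i S| ≤ N * B := fun i S =>
    (Finset.abs_sum_le_sum_abs _ _).trans ((Finset.sum_le_sum (g := fun _ => B) fun s _ => by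
      rw [abs_le]
      constructor <;> linarith [hL (u i), hL0 (u i), hf0 (u i) (S s), hB (u i) (S s)]).trans
        (by simp))
  have hbdd : ∀ S, BddAbove (Set.range fun i => G i S) := fun S => by
    refine ⟨N * B, ?_⟩
    rintro _ ⟨i, rfl⟩
    exact (le_abs_self _).trans (hG i S)
  have hΨm : Measurable Ψ := Measurable.iSup fun i => Finset.measurable_sum _ fun s _ => by
    have h1 := hf (u i)
    fun_prop
  have hΨ : ∀ S, |Ψ S| ≤ N * B := fun S => abs_le.2
    ⟨(abs_le.1 (hG 0 S)).1.trans (le_ciSup (hbdd S) 0),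
      ciSup_le fun i => (le_abs_self _).trans (hG i S)⟩
  have hGd : ∀ i S S' (s : Fin N), (∀ r, r ≠ s → S r = S' r) → G i S ≤ G i S' + B := by
    intro i S S' s h
    have h1 : G i S - G i S' = f (u i) (S' s) - f (u i) (S s) := by
      simp only [G]
      rw [← Finset.sum_sub_distrib, Finset.sum_eq_single s]
      · ring
      · intro r _ hr
        rw [h r hr]
        ring
      · intro h
        exact absurd (Finset.mem_univ _) h
    linarith [hf0 (u i) (S s), hB (u i) (S' s)]
  have hΨd' : ∀ S S' (s : Fin N), (∀ r, r ≠ s → S r = S' r) → Ψ S ≤ Ψ S' + B :=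
    fun S S' s h => ciSup_le fun i => (hGd i S S' s h).trans
      (add_le_add_left (le_ciSup (hbdd S') i) B)
  have hΨd : ∀ S s z, |Ψ (Function.update S s z) - Ψ S| ≤ B := fun S s z => by
    have h1 := hΨd' (Function.update S s z) S s fun r hr => Function.update_of_ne hr _ _
    have h2 := hΨd' S (Function.update S s z) s fun r hr => (Function.update_of_ne hr _ _).symm
    rw [abs_le]
    constructor <;> linarith
  set ε := B * √(2 * N * Real.log δ⁻¹)
  have hlog : 0 ≤ Real.log δ⁻¹ := Real.log_nonneg ((one_le_inv₀ hδ).2 hδ'.le)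
  have hε : 0 ≤ ε := by positivity
  have hmean : ∫ S, Ψ S ∂P ≤ 2 * K :=
    integral_iSup_le_of_expect_le μ (fun i => f (u i)) (fun i => hf _) (fun i => habs _) (hK u)
  have htail := measureReal_le_of_bounded_differences μ hN hB0 hε Ψ hΨm hΨ hΨd
  have hexp : Real.exp (-(ε ^ 2 / (2 * N * B ^ 2))) = δ := by
    have : ε ^ 2 / (2 * N * B ^ 2) = Real.log δ⁻¹ := by
      simp only [ε]
      rw [mul_pow, Real.sq_sqrt (by positivity)]
      field_simp
    rw [this, Real.log_inv, neg_neg, Real.exp_log hδ]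
  rw [hexp] at htail
  have hmeas : MeasurableSet {S | ∫ S', Ψ S' ∂P + ε ≤ Ψ S} := measurableSet_le measurable_const hΨm
  refine ⟨_, hmeas.compl, ?_, ?_⟩
  · rw [probReal_compl_eq_one_sub hmeas]
    linarith
  · intro S hS t
    have hS' : Ψ S < ∫ S', Ψ S' ∂P + ε := not_le.1 hS
    -- the inequality is closed in `t`, so that it suffices to have it along the dense sequence
    have hcont : Continuous fun t => ∫ z, f t z ∂μ :=
      continuous_of_dominated (fun t => (hf t).aestronglyMeasurable) (bound := fun _ => B)
        (fun t => ae_of_all _ (habs t)) (integrable_const _) (ae_of_all _ hfc)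
    refine (TopologicalSpace.denseRange_denseSeq T).induction_on t
      (isClosed_le hcont (by fun_prop)) fun i => ?_
    have h1 : G i S ≤ ε + 2 * K := (le_ciSup (hbdd S) i).trans (by linarith)
    have h2 : G i S = N * ∫ z, f (u i) z ∂μ - ∑ s, f (u i) (S s) := by
      simp only [G]
      rw [Finset.sum_sub_distrib]
      simp
    rw [h2] at h1
    have h3 : ∫ z, f (u i) z ∂μ ≤ (∑ s, f (u i) (S s) + (ε + 2 * K)) / N := by
      rw [le_div_iff₀ hNR]
      linarith
    refine h3.trans (le_of_eq ?_)
    simp only [u]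
    ring

/-- Uniform deviation bound for linear prediction with the norm loss. For almost every data point all
predictors in `H` send the input into the balls of radii `R` and `Bout`: the first radius enters
through the complexity of the class, the second through the size of the loss. -/
theorem exists_event_integral_norm_sub_le {κ E F : Type*} [Fintype κ] [Nonempty κ]
    [NormedAddCommGroup E] [NormedSpace ℝ E] [FiniteDimensional ℝ E] [MeasurableSpace E]
    [BorelSpace E] [NormedAddCommGroup F] [NormedSpace ℝ F] [FiniteDimensional ℝ F]
    [MeasurableSpace F] [BorelSpace F] {N p : ℕ} (hN : 0 < N) (hp : 0 < p)
    (hE : Module.finrank ℝ E ≤ p) (e : κ → F →ₗ[ℝ] ℝ) (he₁ : ∀ v, ‖v‖ ≤ ∑ k, |e k v|)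
    (he₂ : ∀ v, ∑ k, e k v ^ 2 ≤ ‖v‖ ^ 2) {R Bout Btgt δ : ℝ}
    (hR : 0 ≤ R) (hBout : 0 < Bout) (hδ : 0 < δ) (hδ' : δ < 1)
    (μ : Measure (E × F)) [IsProbabilityMeasure μ] (H : Set (E → F))
    (hlin : ∀ h ∈ H, IsLinearMap ℝ h)
    (htgt : ∀ᵐ z ∂μ, ‖z.2‖ ≤ Btgt) (hHR : ∀ᵐ z ∂μ, ∀ h ∈ H, ‖h z.1‖ ≤ R)
    (hout : ∀ᵐ z ∂μ, ∀ h ∈ H, ‖h z.1‖ ≤ Bout) :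
    ∃ Ev : Set (Fin N → E × F), MeasurableSet Ev ∧
      1 - δ ≤ (Measure.pi fun _ : Fin N => μ).real Ev ∧
      ∀ S ∈ Ev, ∀ h ∈ H, ∫ z, ‖h z.1 - z.2‖ ∂μ ≤ 1 / N * ∑ s, ‖h (S s).1 - (S s).2‖ +
        ((Bout + Btgt) * √(2 * N * Real.log δ⁻¹) +
          2 * (Fintype.card κ * √p * (√N * R))) / N := by
  have hlin' : ∀ h ∈ H, ∃ A : E →L[ℝ] F, ⇑A = h := fun h hh =>
    ⟨LinearMap.toContinuousLinearMap ((hlin h hh).mk' h), rfl⟩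
  rcases H.eq_empty_or_nonempty with rfl | hne
  · exact ⟨Set.univ, MeasurableSet.univ, by simp [hδ.le], by simp⟩
  -- a measurable set of full measure of data on which all bounds hold
  obtain ⟨G, hGsub, hGm, hG1⟩ : ∃ G : Set (E × F),
      (∀ z ∈ G, ‖z.2‖ ≤ Btgt ∧ (∀ h ∈ H, ‖h z.1‖ ≤ R) ∧ ∀ h ∈ H, ‖h z.1‖ ≤ Bout) ∧
      MeasurableSet G ∧ ∀ᵐ z ∂μ, z ∈ G := by
    have h := htgt.and (hHR.and hout)
    obtain ⟨B, hB, hBm, hB0⟩ := exists_measurable_superset_of_null h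
    exact ⟨Bᶜ, fun z hz => not_not.1 fun hz' => hz (hB hz'), hBm.compl, by
      rw [ae_iff]; simpa using hB0⟩
  have hBtgt : 0 ≤ Btgt := by
    obtain ⟨z, hz⟩ := htgt.exists
    exact (norm_nonneg _).trans hz
  -- outside that set the data are replaced by `0`, which a linear network maps to `0`
  let x : E × F → E := G.indicator Prod.fst
  let y : E × F → F := G.indicator Prod.snd
  have hx : Measurable x := measurable_fst.indicator hGm
  have hy : Measurable y := measurable_snd.indicator hGm
  let T := {A : E →L[ℝ] F // ⇑A ∈ H}
  have : Nonempty T := by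
    obtain ⟨h, hh⟩ := hne
    obtain ⟨A, rfl⟩ := hlin' h hh
    exact ⟨⟨A, hh⟩⟩
  have hyB : ∀ z, ‖y z‖ ≤ Btgt := fun z => by
    by_cases hz : z ∈ G
    · simpa [y, hz] using (hGsub z hz).1
    · simpa [y, hz] using hBtgt
  have hAR : ∀ (A : T) z, ‖A.1 (x z)‖ ≤ R := fun A z => by
    by_cases hz : z ∈ G
    · simpa [x, hz] using (hGsub z hz).2.1 _ A.2
    · simpa [x, hz] using hR
  have hAB : ∀ (A : T) z, ‖A.1 (x z)‖ ≤ Bout := fun A z => by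
    by_cases hz : z ∈ G
    · simpa [x, hz] using (hGsub z hz).2.2 _ A.2
    · simpa [x, hz] using hBout.le
  let f : T → E × F → ℝ := fun A z => ‖A.1 (x z) - y z‖
  have hfB : ∀ A z, f A z ≤ Bout + Btgt := fun A z =>
    (norm_sub_le _ _).trans (add_le_add (hAB A z) (hyB z))
  have hfm : ∀ A, Measurable (f A) := fun A =>
    ((A.1.continuous.measurable.comp hx).sub hy).norm
  have hfc : ∀ z, Continuous fun A => f A z := fun z => by
    have : Continuous fun A : T => A.1 (x z) :=
      (ContinuousLinearMap.apply ℝ (F) (x z)).continuous.comp continuous_subtype_val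
    exact (this.sub continuous_const).norm
  have hK : ∀ (u : ℕ → T) (S : Fin N → E × F),
      (Finset.expect Finset.univ fun σ : Fin N → ℤˣ =>
        ⨆ i, ∑ s, ((σ s : ℤ) : ℝ) * f (u i) (S s)) ≤ Fintype.card κ * √p * (√N * R) := fun u S =>
    expect_iSup_norm_sub_le hR hp hE e he₁ he₂ (fun i => ((u i).1 : E →ₗ[ℝ] F))
      (fun s => x (S s)) (fun s => y (S s)) (fun i s => hAR (u i) _) (fun i s => hfB (u i) _)
  obtain ⟨Ev, hEm, hE, hES⟩ := exists_event_integral_le μ hN (by positivity : 0 < Bout + Btgt)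
    hδ hδ' f hfm hfc (fun A z => norm_nonneg _) hfB hK
  have hgood : ∀ᵐ S ∂(Measure.pi fun _ : Fin N => μ), ∀ s, S s ∈ G :=
    ae_all_iff.2 fun s => (measurePreserving_eval (fun _ : Fin N => μ) s).quasiMeasurePreserving.ae hG1
  refine ⟨Ev ∩ {S | ∀ s, S s ∈ G}, hEm.inter ?_, ?_, ?_⟩
  · rw [Set.ofPred_forall]
    exact MeasurableSet.iInter fun s => measurable_pi_apply s hGm
  · refine hE.trans (le_of_eq (measureReal_congr ?_))
    filter_upwards [hgood] with S hS
    exact propext ⟨fun h => ⟨h, hS⟩, fun h => h.1⟩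
  · rintro S ⟨hSE, hSG⟩ h hh
    obtain ⟨A, rfl⟩ := hlin' h hh
    have h1 := hES S hSE ⟨A, hh⟩
    have h2 : ∫ z, ‖A z.1 - z.2‖ ∂μ = ∫ z, f ⟨A, hh⟩ z ∂μ := integral_congr_ae <| by
      filter_upwards [hG1] with z hz
      simp [f, x, y, hz]
    have h3 : 1 / N * ∑ s, ‖A (S s).1 - (S s).2‖ = 1 / N * ∑ s, f ⟨A, hh⟩ (S s) := by
      have : ∀ s, S s ∈ G := hSG
      simp [f, x, y, this]
    rw [h2, h3]
    exact h1

/-! ### Matrices with the Frobenius norm -/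

/-- The product sigma-algebra on matrices is the Borel sigma-algebra of the Frobenius norm. -/
theorem borelSpace_frobenius {m k α : Type*} [Fintype m] [Fintype k] [NormedAddCommGroup α]
    [MeasurableSpace α] [BorelSpace α] [SecondCountableTopology α] :
    @BorelSpace (Matrix m k α)
      (Matrix.frobeniusNormedAddCommGroup (m := m) (n := k)
        (α := α)).toSeminormedAddCommGroup.toPseudoMetricSpace.toUniformSpace.toTopologicalSpace _ :=
  inferInstanceAs (BorelSpace (m → k → α))

theorem frobenius_norm_sq {m k α : Type*} [Fintype m] [Fintype k] [NormedAddCommGroup α]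
    (A : Matrix m k α) : ‖A‖ ^ 2 = ∑ i, ∑ j, ‖A i j‖ ^ 2 := by
  rw [Matrix.frobenius_norm_def, ← Real.sqrt_eq_rpow, Real.sq_sqrt (by positivity)]
  simp

theorem frobenius_norm_le_sum {m k α : Type*} [Fintype m] [Fintype k] [NormedAddCommGroup α]
    (A : Matrix m k α) : ‖A‖ ≤ ∑ p : m × k, ‖A p.1 p.2‖ := by
  refine le_of_sq_le_sq ?_ (Finset.sum_nonneg fun _ _ => norm_nonneg _)
  rw [frobenius_norm_sq, ← Fintype.sum_prod_type' (f := fun i j => ‖A i j‖ ^ 2)]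
  exact Finset.sum_sq_le_sq_sum_of_nonneg fun _ _ => norm_nonneg _

/-! ### Linearity and size of the networks -/

theorem channel_add {n nρ : ℕ} (ω₁ ω : ℝ) (K : Matrix (Fin n) (Fin nρ) ℂ)
    (D X Y : Matrix (Fin n) (Fin n) ℂ) :
    channel ω₁ ω K D (X + Y) = channel ω₁ ω K D X + channel ω₁ ω K D Y := by
  have h1 : ∀ X Y, phi1 ω K D (X + Y) = phi1 ω K D X + phi1 ω K D Y := fun X Y => by
    simp only [phi1, Matrix.mul_add, Matrix.add_mul, Matrix.diag_add, smul_add]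
    abel
  have h2 : ∀ X Y, phi2 ω K (X + Y) = phi2 ω K X + phi2 ω K Y := fun X Y => by
    simp only [phi2, Matrix.mul_add, Matrix.add_mul, Matrix.diag_add, smul_add]
  have h3 : ∀ f g : Fin n → Fin nρ → ℂ,
      (Matrix.of fun m => f m + g m) = Matrix.of f + Matrix.of g := fun f g => rfl
  simp only [channel, Matrix.mul_add, Matrix.add_mul, h1, h2, h3]
  abel

theorem channel_smul {n nρ : ℕ} (ω₁ ω : ℝ) (K : Matrix (Fin n) (Fin nρ) ℂ)
    (D X : Matrix (Fin n) (Fin n) ℂ) (c : ℝ) :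
    channel ω₁ ω K D (c • X) = c • channel ω₁ ω K D X := by
  have h1 : ∀ X, phi1 ω K D (c • X) = c • phi1 ω K D X := fun X => by
    simp only [phi1, Matrix.mul_smul, Matrix.smul_mul, ← smul_add, Matrix.diag_smul]
    rw [smul_comm]
  have h2 : ∀ X, phi2 ω K (c • X) = c • phi2 ω K X := fun X => by
    simp only [phi2, Matrix.mul_smul, Matrix.smul_mul, Matrix.diag_smul]
    rw [smul_comm]
  have h3 : ∀ f : Fin n → Fin nρ → ℂ, (Matrix.of fun m => c • f m) = c • Matrix.of f :=
    fun f => rfl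
  simp only [channel, Matrix.mul_smul, Matrix.smul_mul, h1, h2, h3, smul_add]

/-- A butterfly network is real-linear in the scattering data, whatever its weights. -/
theorem isLinearMap_bfnn {n nρ : ℕ} (ω₁ ω₂ : ℝ) (K : Matrix (Fin n) (Fin nρ) ℂ)
    (D : Matrix (Fin n) (Fin n) ℂ) : IsLinearMap ℝ (bfnn ω₁ ω₂ K D) where
  map_add X Y := by
    simp only [bfnn, Matrix.mul_add, channel_add]
    abel
  map_smul c X := by
    simp only [bfnn, Matrix.mul_smul, channel_smul, smul_add]

theorem isLinearMap_of_mem_hypNet {n nρ nr r : ℕ} {ω₁ ω₂ α BU BM BV BD : ℝ}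
    {h : CMat n → RMat n} (hh : h ∈ hypNet n nρ nr r ω₁ ω₂ α BU BM BV BD) :
    IsLinearMap ℝ h := by
  obtain ⟨ψ, ψ₀, φ, -, -, ⟨U, M, V, D, -, -, -, -, -, -, -, rfl⟩, rfl⟩ := hh
  exact (ψ ∘ₗ ψ₀ ∘ₗ (isLinearMap_bfnn ω₁ ω₂ (U * M * V) D).mk' _).isLinear

/-- The norm bounds on the outer layers turn the bound on the outputs of the butterfly networks into
one on the outputs of the full networks. -/
theorem norm_le_of_mem_hypNet {n nρ nr r : ℕ} {ω₁ ω₂ α BU BM BV BD Bout : ℝ} (hα : 0 < α)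
    {h : CMat n → RMat n} (hh : h ∈ hypNet n nρ nr r ω₁ ω₂ α BU BM BV BD) {Λ : CMat n}
    (hΛ : ∀ φ ∈ hypBFNN n nρ nr r ω₁ ω₂ BU BM BV BD, ‖φ Λ‖ ≤ Bout) :
    ‖h Λ‖ ≤ 4 * α⁻¹ * Bout := by
  obtain ⟨ψ, ψ₀, φ, hψ, hψ₀, hφ, rfl⟩ := hh
  calc ‖ψ (ψ₀ (φ Λ))‖ ≤ 2 * α⁻¹ * ‖ψ₀ (φ Λ)‖ := hψ _
    _ ≤ 2 * α⁻¹ * (2 * Bout) := by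
        have := (hψ₀ (φ Λ)).trans (mul_le_mul_of_nonneg_left (hΛ φ hφ) zero_le_two)
        gcongr
    _ = 4 * α⁻¹ * Bout := by ring

/-- The deviation bound for linear networks between the matrix spaces at hand, whose real dimensions
are `4 n²` and `2 n²`. -/
theorem exists_event_trueLoss_le {n N : ℕ} (hn : 0 < n) (hN : 0 < N) {R Bout Btgt δ : ℝ}
    (hR : 0 ≤ R) (hBout : 0 < Bout) (hδ : 0 < δ) (hδ' : δ < 1)
    (μ : Measure (CMat n × RMat n)) [IsProbabilityMeasure μ] (H : Set (CMat n → RMat n))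
    (hlin : ∀ h ∈ H, IsLinearMap ℝ h)
    (htgt : ∀ᵐ z ∂μ, ‖z.2‖ ≤ Btgt) (hHR : ∀ᵐ z ∂μ, ∀ h ∈ H, ‖h z.1‖ ≤ R)
    (hout : ∀ᵐ z ∂μ, ∀ h ∈ H, ‖h z.1‖ ≤ Bout) :
    ∃ E : Set (Fin N → CMat n × RMat n), MeasurableSet E ∧
      1 - δ ≤ (Measure.pi fun _ : Fin N => μ).real E ∧
      ∀ S ∈ E, ∀ h ∈ H, trueLoss μ h ≤ empRisk S h +
        ((Bout + Btgt) * √(2 * N * Real.log δ⁻¹) + 2 * (4 * n ^ 3 * (√N * R))) / N := by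
  have := borelSpace_frobenius (m := Fin n ⊕ Fin n) (k := Fin n) (α := ℂ)
  have := borelSpace_frobenius (m := Fin n ⊕ Fin n) (k := Fin n) (α := ℝ)
  have : Nonempty (Fin n) := ⟨⟨0, hn⟩⟩
  have hfin : Module.finrank ℝ (CMat n) = 4 * n ^ 2 := by
    rw [Module.finrank_matrix]
    simp
    ring
  let e : (Fin n ⊕ Fin n) × Fin n → RMat n →ₗ[ℝ] ℝ := fun k =>
    { toFun := fun A => A k.1 k.2
      map_add' := fun _ _ => rfl
      map_smul' := fun _ _ => rfl }
  have hcard : (Fintype.card ((Fin n ⊕ Fin n) × Fin n) : ℝ) = 2 * n ^ 2 := by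
    simp
    ring
  have hsqrt : √((4 * n ^ 2 : ℕ) : ℝ) = 2 * n := by
    rw [show ((4 * n ^ 2 : ℕ) : ℝ) = (2 * n) ^ 2 by push_cast; ring]
    exact Real.sqrt_sq (by positivity)
  have he₂ : ∀ v, ∑ k, e k v ^ 2 ≤ ‖v‖ ^ 2 := fun v => by
    rw [frobenius_norm_sq, Fintype.sum_prod_type]
    simp only [Real.norm_eq_abs, sq_abs]
    exact le_rfl
  have h := exists_event_integral_norm_sub_le hN (by positivity : 0 < 4 * n ^ 2) hfin.le e
    frobenius_norm_le_sum he₂ hR hBout hδ hδ' μ H hlin htgt hHR hout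
  have hconst : 2 * (n : ℝ) ^ 2 * (2 * n) * (√N * R) = 4 * n ^ 3 * (√N * R) := by ring
  rw [hcard, hsqrt, hconst] at h
  exact h

end BFNN

/-! ### The generalization bound -/

theorem mainTheorem8
    (n nρ nr r N : ℕ) (ω₁ ω₂ α BU BM BV BD Bin Btgt Bout δ : ℝ)
    (hnr : 0 < nr) (hr : 0 < r) (hN : 0 < N)
    (hω₁ : 0 < ω₁) (hω : ω₁ < ω₂) (hκ : ∃ κ : ℕ, ω₂ / ω₁ = κ)
    (hnρ : (n : ℝ) = ω₁ / ω₂ * nρ) (hdvd : nr ∣ n) (hdvd' : nr ∣ nρ)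
    (hrank : ω₂ / ω₁ * nr * r ≤ n)
    (hα : 0 < α) (hBout : 0 < Bout) (hδ : 0 < δ) (hδ' : δ < 1)
    (μ : Measure (BFNN.CMat n × BFNN.RMat n)) [IsProbabilityMeasure μ]
    (hin : ∀ᵐ z ∂μ, ‖z.1‖ ≤ Bin)
    (htgt : ∀ᵐ z ∂μ, ‖z.2‖ ≤ Btgt)
    (hmid : ∀ᵐ z ∂μ, ∀ φ ∈ BFNN.hypBFNN n nρ nr r ω₁ ω₂ BU BM BV BD, ‖φ z.1‖ ≤ Bout)
    (hout : ∀ᵐ z ∂μ, ∀ h ∈ BFNN.hypNet n nρ nr r ω₁ ω₂ α BU BM BV BD, ‖h z.1‖ ≤ Bout) :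
    ∃ E : Set (Fin N → BFNN.CMat n × BFNN.RMat n), MeasurableSet E ∧
      1 - δ ≤ (Measure.pi fun _ : Fin N => μ).real E ∧
      ∀ S ∈ E, ∀ h ∈ BFNN.hypNet n nρ nr r ω₁ ω₂ α BU BM BV BD,
        BFNN.trueLoss μ h ≤ BFNN.empRisk S h +
          2 ^ 2 * (√(2 * Real.log (4 * δ⁻¹)) * (Bout + Btgt) +
            2 ^ 6 * 3 * √2 * Bout * α⁻¹ *
              (1 + BFNN.cOne ω₁ ω₂ BU BM BV BD Bin * Bout⁻¹ * (n : ℝ) ^ (-(3 / 2) : ℝ)) ^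
                (1 / 2 : ℝ) * (n : ℝ) ^ 3) * (N : ℝ) ^ (-(1 / 2) : ℝ) := by
  have hNR : (0 : ℝ) < N := by exact_mod_cast hN
  have hn : 0 < n := by
    have h1 : (0 : ℝ) < ω₂ / ω₁ * nr * r := by
      have := hω₁.trans hω
      positivity
    exact_mod_cast h1.trans_le hrank
  have hBin : 0 ≤ Bin := by
    obtain ⟨z, hz⟩ := hin.exists
    exact (norm_nonneg _).trans hz
  have hBtgt : 0 ≤ Btgt := by
    obtain ⟨z, hz⟩ := htgt.exists
    exact (norm_nonneg _).trans hz
  have hR : 0 ≤ 4 * α⁻¹ * Bout := by positivity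
  obtain ⟨E, hEm, hE, hES⟩ := BFNN.exists_event_trueLoss_le hn hN hR hBout hδ hδ' μ
    (BFNN.hypNet n nρ nr r ω₁ ω₂ α BU BM BV BD)
    (fun h hh => BFNN.isLinearMap_of_mem_hypNet hh) htgt
    (hmid.mono fun z hz h hh => BFNN.norm_le_of_mem_hypNet hα hh hz) hout
  refine ⟨E, hEm, hE, fun S hS h hh => (hES S hS h hh).trans (add_le_add_right ?_ _)⟩
  have hrpow : (N : ℝ) ^ (-(1 / 2) : ℝ) = √N / N := by
    rw [Real.rpow_neg hNR.le, ← Real.sqrt_eq_rpow, Real.sqrt_div_self', one_div]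
  have hlog : 2 * N * Real.log δ⁻¹ ≤ N * (2 * Real.log (4 * δ⁻¹)) := by
    have h1 : Real.log δ⁻¹ ≤ Real.log (4 * δ⁻¹) :=
      Real.log_le_log (by positivity) (by linarith [inv_pos.2 hδ])
    nlinarith
  have hsqrt : √(2 * N * Real.log δ⁻¹) ≤ √N * √(2 * Real.log (4 * δ⁻¹)) := by
    rw [← Real.sqrt_mul hNR.le]
    exact Real.sqrt_le_sqrt hlog
  -- the factor with `cOne` is used only through this lower bound
  have hc : 1 ≤ (1 + BFNN.cOne ω₁ ω₂ BU BM BV BD Bin * Bout⁻¹ * (n : ℝ) ^ (-(3 / 2) : ℝ)) ^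
      (1 / 2 : ℝ) := by
    refine Real.one_le_rpow ?_ (by norm_num)
    have : 0 ≤ BFNN.cOne ω₁ ω₂ BU BM BV BD Bin := by
      unfold BFNN.cOne
      positivity
    have : 0 ≤ BFNN.cOne ω₁ ω₂ BU BM BV BD Bin * Bout⁻¹ * (n : ℝ) ^ (-(3 / 2) : ℝ) := by positivity
    linarith
  set C := (1 + BFNN.cOne ω₁ ω₂ BU BM BV BD Bin * Bout⁻¹ * (n : ℝ) ^ (-(3 / 2) : ℝ)) ^ (1 / 2 : ℝ)
  have h2 : (1 : ℝ) ≤ √2 * C := one_le_mul_of_one_le_of_one_le (Real.one_le_sqrt.2 one_le_two) hc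
  rw [hrpow, ← mul_div_assoc]
  refine div_le_div_of_nonneg_right ?_ hNR.le
  have t1 : (Bout + Btgt) * √(2 * N * Real.log δ⁻¹) ≤
      2 ^ 2 * ((√(2 * Real.log (4 * δ⁻¹)) * (Bout + Btgt)) * √N) := by
    have h3 : 0 ≤ (Bout + Btgt) * (√N * √(2 * Real.log (4 * δ⁻¹))) := by positivity
    have h4 := mul_le_mul_of_nonneg_left hsqrt (by positivity : 0 ≤ Bout + Btgt)
    nlinarith
  have t2 : 2 * (4 * (n : ℝ) ^ 3 * (√N * (4 * α⁻¹ * Bout))) ≤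
      2 ^ 2 * ((2 ^ 6 * 3 * √2 * Bout * α⁻¹ * C * (n : ℝ) ^ 3) * √N) := by
    have h3 : 0 ≤ (n : ℝ) ^ 3 * √N * α⁻¹ * Bout := by positivity
    have h4 := mul_le_mul_of_nonneg_left h2 h3
    nlinarith
  linarith
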